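/- Consider the following game between a learner and an oblivious adversary, with $k \ge 2$ actions and $T$ rounds. Fix $\varepsilon \in (0,1]$. Before the game starts, the adversary chooses loss vectors $\ell_1,\dots,\ell_T \in [-1,1]^k$. In round $t$ the learner picks an action $A_t \in \{1,\dots,k\}$, at random from a distribution that depends measurably on the history $(A_s,\phi_s)_{s<t}$; it incurs the unobserved loss $e_{A_t}^\top \ell_t = \ell_t(A_t)$ and observes only the real number $\phi_t = M_{A_t}^\top \ell_t$, where $$M_a = (1-\varepsilon)\,\frac{\mathbf 1_k}{k} + \varepsilon\, e_a .$$ The minimax regret is $$R_T^* = \inf_{\text{policies}}\ \sup_{\ell_1,\dots,\ell_T \in [-1,1]^k}\ \Big( \mathbb E\Big[\sum_{t=1}^T \ell_t(A_t)\Big] - \min_{a} \sum_{t=1}^T \ell_t(a) \Big).$$ Theorem (bandits with ill-conditioned observers). The minimax regret is $\tilde\Omega\big(\tfrac1\varepsilon\sqrt{kT}\big)$, in the following precise sense: for all integers $k \ge 2$ and $T \ge 1$ and every $\varepsilon \in (0,1]$ with $T \ge \dfrac{k}{8\,\varepsilon^2 \log(16T)}$, $$R_T^* \ \ge\ \frac{1}{64\sqrt{2\log(16T)}}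 \cdot \frac{1}{\varepsilon}\sqrt{kT}.$$ This matches the upper bound up to logarithmic factors: there is a universal constant $C>0$ such that, for all integers $k \ge 2$ and $T \ge 0$ and every $\varepsilon \in (0,1]$, $$R_T^* \ \le\ C\,\frac{1}{\varepsilon}\sqrt{kT\log k}.$$ -/

import Mathlib

open MeasureTheory ProbabilityTheory

namespace LinearPM

/-- A linear partial monitoring game with `k` actions and losses in `ℝ^d`, in which every action has
a single observation column (so every signal is one real number). Action `a` has the feature
vector `feature a` and the observation vector `obs a`; the loss vectors range over the convex compact
set `Loss`, which contains a centered Euclidean ball, and losses of any two actions differ by at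
most 2. -/
structure Game (k d : ℕ) where
  feature : Fin k → (Fin d → ℝ)
  obs : Fin k → (Fin d → ℝ)
  Loss : Set (Fin d → ℝ)
  convex_loss : Convex ℝ Loss
  compact_loss : IsCompact Loss
  ball_subset : ∃ r : ℝ, 0 < r ∧ {x : Fin d → ℝ | ∑ i, x i ^ 2 ≤ r ^ 2} ⊆ Loss
  bounded : ∀ a b : Fin k, ∀ l ∈ Loss, |(feature a - feature b) ⬝ᵥ l| ≤ 2

/-- A (possibly randomized) policy for `T` rounds and `k` actions: in round `t` (rounds are numbered
from `0`), a probability kernel maps the history of the `t` previous pairs (action, signal) to a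
distribution over the actions. -/
structure Policy (k T : ℕ) where
  kernel : (t : Fin T) → Kernel (Fin (t : ℕ) → Fin k × ℝ) (Fin k)
  markov : ∀ t, IsMarkovKernel (kernel t)

namespace Game

variable {k d : ℕ} (G : Game k d) {T : ℕ}

/-- The loss of action `a` against the loss vector `l`. -/
def actionLoss (a : Fin k) (l : Fin d → ℝ) : ℝ := G.feature a ⬝ᵥ l

/-- The signal observed when `a` is played against the loss vector `l`. -/
def signal (a : Fin k) (l : Fin d → ℝ) : ℝ := G.obs a ⬝ᵥ l

/-- The history of (action, signal) pairs available at the beginning of round `t`, when the loss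
vectors are `l` and the actions are `A`. -/
def history (l : Fin T → (Fin d → ℝ)) (A : Fin T → Fin k) (t : Fin T) :
    Fin (t : ℕ) → Fin k × ℝ :=
  fun s => (A (s.castLE t.isLt.le), G.signal (A (s.castLE t.isLt.le)) (l (s.castLE t.isLt.le)))

/-- The probability that the policy `p` plays exactly the action sequence `A` against the fixed
sequence of loss vectors `l`. As `l` is fixed in advance, the signals are functions of the actions,
so this is the product of the conditional probabilities of the individual actions given the past. -/
noncomputable def actionProb (p : Policy k T) (l : Fin T → (Fin d → ℝ)) (A : Fin T → Fin k) : ℝ :=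
  ∏ t, (p.kernel t (G.history l A t)).real {A t}

/-- The regret of the policy `p` against the sequence of loss vectors `l`: the expected total loss of
the learner minus the total loss of the best fixed action. -/
noncomputable def regret (p : Policy k T) (l : Fin T → (Fin d → ℝ)) : ℝ :=
  ∑ A : Fin T → Fin k, G.actionProb p l A * ∑ t, G.actionLoss (A t) (l t)
    - ⨅ a : Fin k, ∑ t, G.actionLoss a (l t)

/-- The minimax regret over `T` rounds: the infimum over policies of the supremum, over sequences of
`T` loss vectors from the loss space, of the regret. It is taken in the extended reals, so that the
infimum and the supremum always have their order-theoretic meaning. -/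
noncomputable def minimaxRegret (T : ℕ) : EReal :=
  ⨅ p : Policy k T, ⨆ l : Fin T → G.Loss, ((G.regret p (fun t => (l t : Fin d → ℝ)) : ℝ) : EReal)

end Game

/-- The bandit game with ill-conditioned observers: `d = k`, action `a` has the feature vector `e_a`
and the observation vector `(1 - ε) 1 / k + ε e_a`, and the loss space is the unit ball of the
sup norm (the norm of `Fin k → ℝ`). -/
noncomputable def illConditionedBandit (k : ℕ) (ε : ℝ) : Game k k where
  feature a := Pi.single a 1
  obs a := fun i => (1 - ε) * (1 / (k : ℝ)) + ε * (Pi.single a (1 : ℝ) : Fin k → ℝ) i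
  Loss := Metric.closedBall 0 1
  convex_loss := convex_closedBall 0 1
  compact_loss := isCompact_closedBall 0 1
  ball_subset := by
    refine ⟨1, one_pos, fun x hx => ?_⟩
    rw [mem_closedBall_zero_iff, pi_norm_le_iff_of_nonneg zero_le_one]
    intro i
    have h1 : x i ^ 2 ≤ ∑ j, x j ^ 2 :=
      Finset.single_le_sum (f := fun j => x j ^ 2) (fun j _ => sq_nonneg _) (Finset.mem_univ i)
    have h2 : ∑ j, x j ^ 2 ≤ (1 : ℝ) ^ 2 := hx
    rw [Real.norm_eq_abs]
    exact abs_le_of_sq_le_sq (h1.trans h2) zero_le_one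
  bounded := by
    intro a b l hl
    rw [mem_closedBall_zero_iff, pi_norm_le_iff_of_nonneg zero_le_one] at hl
    rw [sub_dotProduct, single_one_dotProduct, single_one_dotProduct]
    have ha := abs_le.1 (hl a)
    have hb := abs_le.1 (hl b)
    rw [abs_le]
    constructor <;> linarith [ha.1, ha.2, hb.1, hb.2]

end LinearPM

/-!
The minimax regret of the bandit with ill-conditioned observers is of order `√(kT) / ε`, up to
logarithmic factors.

The action `a` has the signal `(1 - ε) * mean ℓ + ε * ℓ a`, so the signals of two actions differ by
`ε` times the difference of their losses, and the regret is `1 / ε` times the regret measured in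
signals. Both bounds follow from this.

*Upper bound.* The signals lie in `[-1, 1]` and are ordinary bandit feedback for themselves. Exp3, run
on the signals, has regret of order `√(kT log k)` in signals (`regret_exp3Policy_le`). It is obtained
from the deterministic bound for exponential weights along one history (`sum_loss_le`) by averaging
over the actions, since importance-weighted estimates are unbiased.

*Lower bound.* In the environment `j`, all actions share a noisy loss, and `j` is sometimes better than
the others by `1 / 2`. The common part of the losses compensates the mean, so that the signal of every
other action is the noise alone, uniform on a grid of step `ε / 2` in `[-1/2, 1/2]`, and an advantage
of `j` moves its signal one grid point down. The probability of a move is proportional to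
`i * (m + 1 - i)` at the `i`-th of the points `0, …, m`. Then the distribution of the signal of `j` is
the uniform one with a linear tilt (`sum_noise_signalIndex`); for a mean advantage `Δ` its relative
entropy is at most `32 * (Δ * ε) ^ 2`, as there are about `2 / ε` grid points
(`sum_neg_log_tiltDensity_le`). The noise has bounded support, so no truncation is needed, and it
takes finitely many values, so that all expectations are finite sums over trajectories of an adaptive
process (`law`).

Some action `j` is played at most `T / k` times on average under untilted noise. The relative entropy
between the untilted process and the environment `j` is the expected number of these plays times that
of one signal (`sum_law_mul_neg_log`). It is at most `1 / 16` if `Δ` is of order `√(k / T) / ε`, so `j`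
is played at most `3 * T / 4` times in the environment `j` (`exists_plays_tilt_le`), and the mean regret
there is at least `Δ * T / 4` (`exists_le_regret`). The logarithm in the bound enters only through this
choice of `Δ`: it makes the hypothesis on `T` equivalent to `Δ ≤ 1 / 8`, which the construction needs.
-/

namespace LinearPM

/-! ### Laws of adaptive processes with finitely many states -/

section AdaptiveLaw

variable {X Y : Type*} {T : ℕ}

/-- The coordinates of the sequence `A` before time `t`. -/
def past (A : Fin T → X) (t : Fin T) : Fin (t : ℕ) → X := fun s => A (s.castLE t.isLt.le)

/-- The probability of the trajectory `A` of a process whose state at time `t`, given the past `h`,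
is `x` with probability `κ t h x`. -/
def law (κ : (t : Fin T) → (Fin (t : ℕ) → X) → X → ℝ) (A : Fin T → X) : ℝ :=
  ∏ t, κ t (past A t) (A t)

theorem past_snoc_castSucc (h : Fin T → X) (x : X) (t : Fin T) :
    past (Fin.snoc h x : Fin (T + 1) → X) t.castSucc = past h t := by
  funext s
  exact Fin.snoc_castSucc (α := fun _ => X) x h (s.castLE t.isLt.le)

theorem past_snoc_last (h : Fin T → X) (x : X) :
    past (Fin.snoc h x : Fin (T + 1) → X) (Fin.last T) = h := by
  funext s
  exact Fin.snoc_castSucc (α := fun _ => X) x h s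

theorem law_snoc (κ : (t : Fin (T + 1)) → (Fin (t : ℕ) → X) → X → ℝ) (h : Fin T → X) (x : X) :
    law κ (Fin.snoc h x : Fin (T + 1) → X)
      = law (fun t => κ t.castSucc) h * κ (Fin.last T) h x := by
  simp only [law, Fin.prod_univ_castSucc, past_snoc_castSucc, past_snoc_last, Fin.snoc_last,
    Fin.snoc_castSucc]

theorem sum_snoc [Fintype X] (f : (Fin (T + 1) → X) → ℝ) :
    ∑ A, f A = ∑ h : Fin T → X, ∑ x, f (Fin.snoc h x : Fin (T + 1) → X) := by
  rw [← (Fin.snocEquiv (fun _ : Fin (T + 1) => X)).sum_comp, Fintype.sum_prod_type,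
    Finset.sum_comm]
  rfl

theorem law_nonneg {κ : (t : Fin T) → (Fin (t : ℕ) → X) → X → ℝ} (hκ : ∀ t h x, 0 ≤ κ t h x)
    (A : Fin T → X) : 0 ≤ law κ A :=
  Finset.prod_nonneg fun _ _ => hκ _ _ _

theorem sum_law [Fintype X] {κ : (t : Fin T) → (Fin (t : ℕ) → X) → X → ℝ}
    (hκ : ∀ t h, ∑ x, κ t h x = 1) : ∑ A, law κ A = 1 := by
  induction T with
  | zero => simp [law]
  | succ T ih =>
    simp only [sum_snoc, law_snoc, ← Finset.mul_sum]
    have h1 : ∀ h, ∑ x, κ (Fin.last T) h x = 1 := hκ (Fin.last T)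
    simp only [h1, mul_one]
    exact ih fun t => hκ t.castSucc

/-- The tower property: in an expectation, the state at time `t` may be averaged given the past. -/
theorem sum_law_mul [Fintype X] {κ : (t : Fin T) → (Fin (t : ℕ) → X) → X → ℝ}
    (hκ : ∀ t h, ∑ x, κ t h x = 1) (t : Fin T) (g : (Fin (t : ℕ) → X) → X → ℝ) :
    ∑ A, law κ A * g (past A t) (A t)
      = ∑ A, law κ A * ∑ x, κ t (past A t) x * g (past A t) x := by
  induction T with
  | zero => exact t.elim0
  | succ T ih =>
    have h1 : ∀ h, ∑ x, κ (Fin.last T) h x = 1 := hκ (Fin.last T)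
    simp only [sum_snoc, law_snoc]
    induction t using Fin.lastCases with
    | last =>
      simp only [past_snoc_last, Fin.snoc_last, mul_assoc, ← Finset.mul_sum, ← Finset.sum_mul]
      refine Finset.sum_congr rfl fun h _ => ?_
      rw [h1 h, one_mul]
    | cast t =>
      simp only [past_snoc_castSucc, Fin.snoc_castSucc, mul_right_comm _ (κ (Fin.last T) _ _),
        ← Finset.mul_sum, h1, mul_one]
      exact ih (κ := fun t => κ t.castSucc) (fun t => hκ t.castSucc) t g

/-- If a map of the state space intertwines the transition probabilities of two processes, then it
pushes the law of the first forward to the law of the second. -/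
theorem sum_law_comp [Fintype X] [Fintype Y] [DecidableEq Y] (Φ : X → Y)
    {κ : (t : Fin T) → (Fin (t : ℕ) → X) → X → ℝ}
    {κ' : (t : Fin T) → (Fin (t : ℕ) → Y) → Y → ℝ}
    (hκ : ∀ t h y, ∑ x with Φ x = y, κ t h x = κ' t (Φ ∘ h) y) (f : (Fin T → Y) → ℝ) :
    ∑ A, law κ A * f (Φ ∘ A) = ∑ B, law κ' B * f B := by
  induction T with
  | zero => simp [law, Subsingleton.elim (Φ ∘ default : Fin 0 → Y) default]
  | succ T ih =>
    have h1 : ∀ h y, ∑ x with Φ x = y, κ (Fin.last T) h x = κ' (Fin.last T) (Φ ∘ h) y :=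
      hκ (Fin.last T)
    have h2 : ∀ (h : Fin T → X) (x : X), Φ ∘ (Fin.snoc h x : Fin (T + 1) → X)
        = (Fin.snoc (Φ ∘ h) (Φ x) : Fin (T + 1) → Y) := fun h x => Fin.comp_snoc Φ h x
    simp only [sum_snoc, law_snoc, h2, mul_assoc, ← Finset.mul_sum]
    rw [← ih (κ := fun t => κ t.castSucc) (fun t h y => hκ t.castSucc h y)
      (fun h => ∑ y, κ' (Fin.last T) h y * f (Fin.snoc h y))]
    refine Finset.sum_congr rfl fun h _ => ?_
    congr 1
    rw [← Finset.sum_fiberwise Finset.univ Φ]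
    refine Finset.sum_congr rfl fun y _ => ?_
    rw [← h1, Finset.sum_mul]
    refine Finset.sum_congr rfl fun x hx => ?_
    rw [(Finset.mem_filter.1 hx).2]

end AdaptiveLaw

/-! ### Change of measure -/

/-- Changing the measure from `P` to `L * P` changes the expectation of a function bounded by `B`
by at most `2 * B` times the root of the relative entropy of `P` with respect to `L * P`. The proof
compares both with the Hellinger distance. -/
theorem sum_mul_likelihood_mul_le {ι : Type*} [Fintype ι] {P L f : ι → ℝ} {B : ℝ}
    (hP : ∀ i, 0 ≤ P i) (hP1 : ∑ i, P i = 1) (hL : ∀ i, 0 < L i) (hL1 : ∑ i, P i * L i = 1)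
    (hB : 0 ≤ B) (hf : ∀ i, |f i| ≤ B) :
    ∑ i, P i * L i * f i ≤ ∑ i, P i * f i + 2 * B * √(∑ i, P i * -Real.log (L i)) := by
  have hsq : ∀ i, √(L i) ^ 2 = L i := fun i => Real.sq_sqrt (hL i).le
  have hhel : ∑ i, P i * (√(L i) - 1) ^ 2 ≤ ∑ i, P i * -Real.log (L i) := by
    have h1 : ∀ i, P i * (√(L i) - 1) ^ 2 ≤ P i * -Real.log (L i) + (P i * L i - P i) := by
      intro i
      have h2 : Real.log √(L i) ≤ √(L i) - 1 := Real.log_le_sub_one_of_pos (Real.sqrt_pos.2 (hL i))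
      rw [Real.log_sqrt (hL i).le] at h2
      have h3 : (√(L i) - 1) ^ 2 ≤ -Real.log (L i) + (L i - 1) := by
        nlinarith [hsq i]
      calc _ ≤ P i * (-Real.log (L i) + (L i - 1)) := mul_le_mul_of_nonneg_left h3 (hP i)
        _ = _ := by ring
    refine (Finset.sum_le_sum fun i _ => h1 i).trans_eq ?_
    rw [Finset.sum_add_distrib, Finset.sum_sub_distrib, hL1, hP1]
    ring
  have hadd : ∑ i, P i * (√(L i) + 1) ^ 2 ≤ 4 := by
    have h1 : ∀ i, P i * (√(L i) + 1) ^ 2 ≤ 2 * (P i * L i + P i) := by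
      intro i
      have h3 : (√(L i) + 1) ^ 2 ≤ 2 * (L i + 1) := by
        nlinarith [hsq i, sq_nonneg (√(L i) - 1)]
      calc _ ≤ P i * (2 * (L i + 1)) := mul_le_mul_of_nonneg_left h3 (hP i)
        _ = _ := by ring
    refine (Finset.sum_le_sum fun i _ => h1 i).trans_eq ?_
    rw [← Finset.mul_sum, Finset.sum_add_distrib, hL1, hP1]
    norm_num
  have hcs : (∑ i, P i * |L i - 1|) ^ 2 ≤ 4 * ∑ i, P i * -Real.log (L i) := by
    have h1 : (∑ i, P i * |L i - 1|) ^ 2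
        ≤ (∑ i, P i * (√(L i) - 1) ^ 2) * ∑ i, P i * (√(L i) + 1) ^ 2 := by
      refine Finset.sum_sq_le_sum_mul_sum_of_sq_le_mul _ (fun i _ => mul_nonneg (hP i) (sq_nonneg _))
        (fun i _ => mul_nonneg (hP i) (sq_nonneg _)) fun i _ => le_of_eq ?_
      have h2 : L i - 1 = (√(L i) - 1) * (√(L i) + 1) := by linear_combination -(hsq i)
      rw [mul_pow, sq_abs, h2]
      ring
    have h2 : 0 ≤ ∑ i, P i * (√(L i) - 1) ^ 2 :=
      Finset.sum_nonneg fun i _ => mul_nonneg (hP i) (sq_nonneg _)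
    nlinarith
  have htv : ∑ i, P i * |L i - 1| ≤ 2 * √(∑ i, P i * -Real.log (L i)) := by
    have h1 := Real.le_sqrt_of_sq_le hcs
    rwa [Real.sqrt_mul (by norm_num), show (4 : ℝ) = 2 ^ 2 by norm_num,
      Real.sqrt_sq (by norm_num)] at h1
  have hdiff : ∑ i, P i * L i * f i - ∑ i, P i * f i ≤ B * ∑ i, P i * |L i - 1| := by
    rw [← Finset.sum_sub_distrib, Finset.mul_sum]
    refine Finset.sum_le_sum fun i _ => ?_
    have h1 : (L i - 1) * f i ≤ |L i - 1| * B :=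
      (le_abs_self _).trans (by rw [abs_mul]; exact mul_le_mul_of_nonneg_left (hf i) (abs_nonneg _))
    nlinarith [mul_le_mul_of_nonneg_left h1 (hP i)]
  nlinarith [mul_le_mul_of_nonneg_left htv hB]

section Bandit

variable {k T : ℕ} {S : Type*}

/-- The transition probabilities of a bandit with policy `π`, in which the signal `s` of the action
`a` has probability `r a s`. -/
def banditKernel (π : (t : Fin T) → (Fin (t : ℕ) → Fin k × S) → Fin k → ℝ) (r : Fin k → S → ℝ)
    (t : Fin T) (h : Fin (t : ℕ) → Fin k × S) (x : Fin k × S) : ℝ :=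
  π t h x.1 * r x.1 x.2

/-- The number of rounds in which the action `j` is played. -/
def plays (j : Fin k) (A : Fin T → Fin k × S) : ℝ := ∑ t, if (A t).1 = j then 1 else 0

/-- The signal probabilities in which `u` is tilted by the density `w` at the action `j`. -/
def tilt (u w : S → ℝ) (j a : Fin k) (s : S) : ℝ := u s * if a = j then w s else 1

theorem plays_nonneg (j : Fin k) (A : Fin T → Fin k × S) : 0 ≤ plays j A :=
  Finset.sum_nonneg fun _ _ => by split_ifs <;> norm_num

theorem plays_le (j : Fin k) (A : Fin T → Fin k × S) : plays j A ≤ T := by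
  have : plays j A ≤ ∑ _t : Fin T, (1 : ℝ) :=
    Finset.sum_le_sum fun _ _ => by split_ifs <;> norm_num
  simpa using this

theorem sum_plays (A : Fin T → Fin k × S) : ∑ j, plays j A = T := by
  unfold plays
  rw [Finset.sum_comm]
  simp

variable {π : (t : Fin T) → (Fin (t : ℕ) → Fin k × S) → Fin k → ℝ}

theorem law_tilt (u w : S → ℝ) (j : Fin k) (A : Fin T → Fin k × S) :
    law (banditKernel π (tilt u w j)) A = law (banditKernel π fun _ => u) A
      * ∏ t, if (A t).1 = j then w (A t).2 else 1 := by
  rw [law, law, ← Finset.prod_mul_distrib]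
  exact Finset.prod_congr rfl fun t _ => by simp only [banditKernel, tilt, mul_assoc]

variable [Fintype S]

theorem sum_banditKernel (hπ : ∀ t h, ∑ a, π t h a = 1) {r : Fin k → S → ℝ}
    (hr : ∀ a, ∑ s, r a s = 1) (t : Fin T) (h : Fin (t : ℕ) → Fin k × S) :
    ∑ x, banditKernel π r t h x = 1 := by
  simp only [banditKernel, Fintype.sum_prod_type, ← Finset.mul_sum, hr, mul_one, hπ]

/-- A function of action and signal, averaged over the signal. -/
theorem sum_law_banditKernel_mul (hπ : ∀ t h, ∑ a, π t h a = 1) {r : Fin k → S → ℝ}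
    (hr : ∀ a, ∑ s, r a s = 1) (t : Fin T) (g : Fin k → S → ℝ) :
    ∑ A, law (banditKernel π r) A * g (A t).1 (A t).2
      = ∑ A, law (banditKernel π r) A * ∑ s, r (A t).1 s * g (A t).1 s := by
  rw [sum_law_mul (sum_banditKernel hπ hr) t fun _ x => g x.1 x.2,
    sum_law_mul (sum_banditKernel hπ hr) t fun _ x => ∑ s, r x.1 s * g x.1 s]
  refine Finset.sum_congr rfl fun A _ => ?_
  congr 1
  simp only [banditKernel, Fintype.sum_prod_type, mul_assoc, ← Finset.mul_sum, ← Finset.sum_mul]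
  simp only [hr, one_mul]

theorem sum_tilt {u w : S → ℝ} (hu1 : ∑ s, u s = 1) (huw : ∑ s, u s * w s = 1) (j a : Fin k) :
    ∑ s, tilt u w j a s = 1 := by
  by_cases h : a = j <;> simp [tilt, h, hu1, huw]

/-- The relative entropy of the untilted law with respect to the tilted one is the expected number
of plays of the tilted action times the relative entropy of a single signal. -/
theorem sum_law_mul_neg_log (hπ : ∀ t h, ∑ a, π t h a = 1) {u w : S → ℝ}
    (hu1 : ∑ s, u s = 1) (hw : ∀ s, 0 < w s) (j : Fin k) :
    ∑ A : Fin T → Fin k × S, law (banditKernel π fun _ => u) A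
        * -Real.log (∏ t, if (A t).1 = j then w (A t).2 else 1)
      = (∑ s, u s * -Real.log (w s)) * ∑ A, law (banditKernel π fun _ => u) A * plays j A := by
  have h1 : ∀ A : Fin T → Fin k × S,
      -Real.log (∏ t, if (A t).1 = j then w (A t).2 else 1)
        = ∑ t, if (A t).1 = j then -Real.log (w (A t).2) else 0 := by
    intro A
    rw [Real.log_prod fun t _ => by split_ifs; exacts [(hw _).ne', one_ne_zero],
      ← Finset.sum_neg_distrib]
    exact Finset.sum_congr rfl fun t _ => by split_ifs <;> simp
  simp only [h1, Finset.mul_sum, plays]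
  rw [Finset.sum_comm, Finset.sum_comm (s := Finset.univ (α := Fin T → Fin k × S))]
  refine Finset.sum_congr rfl fun t _ => ?_
  rw [sum_law_banditKernel_mul hπ (fun _ => hu1) t
    fun a s => if a = j then -Real.log (w s) else 0]
  refine Finset.sum_congr rfl fun A _ => ?_
  by_cases h : (A t).1 = j <;> simp [h, mul_comm]

/-- If the relative entropy of a single signal is small, then some action is not played much more
often than the average, even after its signals have been tilted. -/
theorem exists_plays_tilt_le (hk : 2 ≤ k) (hπ0 : ∀ t h a, 0 ≤ π t h a)
    (hπ : ∀ t h, ∑ a, π t h a = 1) {u w : S → ℝ} (hu : ∀ s, 0 ≤ u s) (hu1 : ∑ s, u s = 1)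
    (hw : ∀ s, 0 < w s) (huw : ∑ s, u s * w s = 1)
    (hkl : (∑ s, u s * -Real.log (w s)) * (T / k) ≤ 1 / 16) :
    ∃ j, ∑ A, law (banditKernel π (tilt u w j)) A * plays j A ≤ 3 / 4 * T := by
  have hk0 : (0 : ℝ) < k := by positivity
  have hsum1 : ∑ A, law (banditKernel π fun _ => u) A = 1 :=
    sum_law (sum_banditKernel hπ fun _ => hu1)
  have hlaw0 : ∀ A, 0 ≤ law (banditKernel π fun _ => u) A :=
    law_nonneg fun t h x => mul_nonneg (hπ0 t h x.1) (hu x.2)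
  -- An action that is played at most an average number of times when no signal is tilted.
  obtain ⟨j, hj⟩ : ∃ j, ∑ A, law (banditKernel π fun _ => u) A * plays j A ≤ T / k := by
    by_contra! hcon
    have h1 : ∑ j, ∑ A, law (banditKernel π fun _ => u) A * plays j A = T := by
      rw [Finset.sum_comm]
      simp only [← Finset.mul_sum, sum_plays, ← Finset.sum_mul, hsum1, one_mul]
    have h2 : ∑ _j : Fin k, (T / k : ℝ)
        < ∑ j, ∑ A, law (banditKernel π fun _ => u) A * plays j A :=
      Finset.sum_lt_sum_of_nonempty ⟨⟨0, by omega⟩, Finset.mem_univ _⟩ fun j _ => hcon j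
    rw [h1] at h2
    simp only [Finset.sum_const, Finset.card_univ, Fintype.card_fin, nsmul_eq_mul] at h2
    rw [mul_div_cancel₀ _ hk0.ne'] at h2
    exact lt_irrefl _ h2
  refine ⟨j, ?_⟩
  set P := law (banditKernel π fun _ => u)
  set D := ∑ s, u s * -Real.log (w s) with hD
  have hD0 : 0 ≤ D := by
    have h1 : ∀ s, u s * (1 - w s) ≤ u s * -Real.log (w s) := fun s =>
      mul_le_mul_of_nonneg_left (by linarith [Real.log_le_sub_one_of_pos (hw s)]) (hu s)
    have h2 := Finset.sum_le_sum fun s (_ : s ∈ Finset.univ) => h1 s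
    simp only [mul_sub, mul_one, Finset.sum_sub_distrib, hu1, huw, sub_self] at h2
    simpa [hD] using h2
  set L : (Fin T → Fin k × S) → ℝ := fun A => ∏ t, if (A t).1 = j then w (A t).2 else 1 with hL
  have hPL : ∀ A, law (banditKernel π (tilt u w j)) A = P A * L A := law_tilt u w j
  have hPL1 : ∑ A, P A * L A = 1 := by
    simp only [← hPL]
    exact sum_law (sum_banditKernel hπ (sum_tilt hu1 huw j))
  have hent : ∑ A, P A * -Real.log (L A) ≤ 1 / 16 := by
    rw [hL, sum_law_mul_neg_log hπ hu1 hw j]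
    exact (mul_le_mul_of_nonneg_left hj hD0).trans hkl
  -- Centring the number of plays halves its supremum norm.
  have hmain := sum_mul_likelihood_mul_le (P := P) (L := L) (f := fun A => plays j A - T / 2)
    (B := T / 2) hlaw0 hsum1
    (fun A => Finset.prod_pos fun t _ => by split_ifs; exacts [hw _, one_pos]) hPL1
    (by positivity) fun A => by
      rw [abs_le]
      constructor <;> linarith [plays_nonneg j A, plays_le j A]
  have hsqrt : √(∑ A, P A * -Real.log (L A)) ≤ 1 / 4 :=
    (Real.sqrt_le_sqrt hent).trans_eq (by
      rw [show (1 / 16 : ℝ) = (1 / 4) ^ 2 by norm_num, Real.sqrt_sq (by norm_num)])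
  simp only [mul_sub, Finset.sum_sub_distrib, ← Finset.sum_mul, hPL1, hsum1] at hmain
  simp only [hPL]
  have hT : (T / k : ℝ) ≤ T / 2 :=
    div_le_div_of_nonneg_left (Nat.cast_nonneg T) (by norm_num) (by exact_mod_cast hk)
  have hT0 : (0 : ℝ) ≤ T := Nat.cast_nonneg T
  nlinarith [mul_le_mul_of_nonneg_left hsqrt hT0]

end Bandit

/-! ### Loss vectors and signals of the bandit with ill-conditioned observers -/

theorem actionLoss_illConditionedBandit {k : ℕ} (ε : ℝ) (a : Fin k) (l : Fin k → ℝ) :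
    (illConditionedBandit k ε).actionLoss a l = l a := by
  simp [Game.actionLoss, illConditionedBandit]

theorem signal_illConditionedBandit {k : ℕ} (ε : ℝ) (a : Fin k) (l : Fin k → ℝ) :
    (illConditionedBandit k ε).signal a l = (1 - ε) * (1 / k) * ∑ b, l b + ε * l a := by
  simp only [Game.signal, illConditionedBandit, dotProduct, add_mul, Finset.sum_add_distrib,
    mul_assoc, ← Finset.mul_sum]
  simp [Pi.single_apply]

theorem mem_loss_illConditionedBandit {k : ℕ} (ε : ℝ) (l : Fin k → ℝ) :
    l ∈ (illConditionedBandit k ε).Loss ↔ ∀ a, |l a| ≤ 1 := by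
  simp [illConditionedBandit, pi_norm_le_iff_of_nonneg zero_le_one]

/-! ### The hard environments -/

section Environment

variable {k m : ℕ} {ε c : ℝ}

/-- The `i`-th point of a grid that has step `ε / 2` and `m + 1` points, centred at `0`. -/
noncomputable def grid (ε : ℝ) (m : ℕ) (i : Fin (m + 1)) : ℝ := ε / 2 * (i - m / 2)

/-- The grid point reached from `ω.1` by moving down one step if `ω.2` holds; the lowest point
stays. -/
def target (ω : Fin (m + 1) × Bool) : Fin (m + 1) :=
  if ω.2 then ⟨ω.1 - 1, by omega⟩ else ω.1

/-- The probability of moving down from the `i`-th grid point. It vanishes at the ends of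
`{0, …, m + 1}` and has a constant second difference, so that the distribution after the move is the
uniform one with a linear tilt. -/
def moveProb (c : ℝ) (m i : ℕ) : ℝ := c * i * (m + 1 - i)

/-- The probability of the grid point `ω.1`, chosen uniformly, and the move `ω.2`. -/
noncomputable def noise (c : ℝ) (m : ℕ) (ω : Fin (m + 1) × Bool) : ℝ :=
  1 / (m + 1) * if ω.2 then moveProb c m ω.1 else 1 - moveProb c m ω.1

/-- The advantage of the distinguished action: the move of the grid point, magnified by `1 / ε`. -/
noncomputable def drop (ε : ℝ) (m : ℕ) (ω : Fin (m + 1) × Bool) : ℝ :=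
  (grid ε m ω.1 - grid ε m (target ω)) / ε

/-- The loss vector in which the action `j` beats the others by `drop ε m ω`. The common part of the
losses is such that every other action has the signal `grid ε m ω.1`. -/
noncomputable def envLoss (ε : ℝ) (m : ℕ) (j : Fin k) (ω : Fin (m + 1) × Bool) (a : Fin k) : ℝ :=
  grid ε m ω.1 + (1 - ε) / k * drop ε m ω - if a = j then drop ε m ω else 0

/-- The density, with respect to the uniform distribution, of the grid point after the move. -/
def tiltDensity (c : ℝ) (m : ℕ) (i : Fin (m + 1)) : ℝ := 1 + c * (m - 2 * i)

/-- The index of the signal of the action `a` if `j` is the distinguished action. -/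
def signalIndex (j a : Fin k) (ω : Fin (m + 1) × Bool) : Fin (m + 1) :=
  if a = j then target ω else ω.1

theorem drop_eq (hε : 0 < ε) (ω : Fin (m + 1) × Bool) :
    drop ε m ω = if ω.2 ∧ (ω.1 : ℕ) ≠ 0 then 1 / 2 else 0 := by
  obtain ⟨⟨i, hi⟩, b⟩ := ω
  cases b
  · simp [drop, target]
  · cases i with
    | zero => simp [drop, target]
    | succ i =>
      simp only [drop, target, grid]
      simp only [if_true, Nat.add_sub_cancel, Nat.cast_succ]
      rw [if_pos ⟨trivial, by simp⟩]
      field_simp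
      ring

theorem drop_mem (hε : 0 < ε) (ω : Fin (m + 1) × Bool) : 0 ≤ drop ε m ω ∧ drop ε m ω ≤ 1 / 2 := by
  rw [drop_eq hε]
  split_ifs <;> norm_num

theorem abs_grid_le (hε : 0 < ε) (hm : ε * m ≤ 2) (i : Fin (m + 1)) : |grid ε m i| ≤ 1 / 2 := by
  have h1 : (i : ℝ) ≤ m := by exact_mod_cast Nat.le_of_lt_succ i.isLt
  have h2 : (0 : ℝ) ≤ i := Nat.cast_nonneg _
  rw [grid, abs_le]
  constructor <;> nlinarith [mul_le_mul_of_nonneg_left h1 hε.le, mul_nonneg hε.le h2]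

theorem abs_envLoss_le (hk : 2 ≤ k) (hε : 0 < ε) (hε1 : ε ≤ 1) (hm : ε * m ≤ 2) (j : Fin k)
    (ω : Fin (m + 1) × Bool) (a : Fin k) : |envLoss ε m j ω a| ≤ 1 := by
  have hg := abs_le.1 (abs_grid_le hε hm ω.1)
  obtain ⟨hd0, hd1⟩ := drop_mem (m := m) hε ω
  have hk0 : (1 : ℝ) ≤ k := by exact_mod_cast (by omega : 1 ≤ k)
  have hq0 : 0 ≤ (1 - ε) / k := div_nonneg (by linarith) (by linarith)
  have hq1 : (1 - ε) / k ≤ 1 := (div_le_one (by linarith)).2 (by linarith)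
  have h1 : 0 ≤ (1 - ε) / k * drop ε m ω := mul_nonneg hq0 hd0
  have h2 : (1 - ε) / k * drop ε m ω ≤ drop ε m ω := mul_le_of_le_one_left hd0 hq1
  rw [envLoss, abs_le]
  split_ifs <;> constructor <;> linarith [hg.1, hg.2]

theorem signal_envLoss (hk : 2 ≤ k) (hε : 0 < ε) (j a : Fin k) (ω : Fin (m + 1) × Bool) :
    (illConditionedBandit k ε).signal a (envLoss ε m j ω) = grid ε m (signalIndex j a ω) := by
  have hk0 : (k : ℝ) ≠ 0 := by positivity
  rw [signal_illConditionedBandit]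
  simp only [envLoss, Finset.sum_sub_distrib, Finset.sum_const, Finset.card_univ, Fintype.card_fin,
    nsmul_eq_mul, Finset.sum_ite_eq', Finset.mem_univ, if_true]
  by_cases h : a = j
  · simp only [h, signalIndex, if_true, drop]
    field_simp
    ring
  · simp only [h, signalIndex, if_false]
    field_simp
    ring

theorem sum_noise_fst (s : Fin (m + 1)) (b : ℝ) :
    noise c m (s, true) * b + noise c m (s, false) * b = 1 / (m + 1) * b := by
  simp only [noise]
  simp
  ring

theorem sum_uniform (m : ℕ) : ∑ _i : Fin (m + 1), (1 / (m + 1) : ℝ) = 1 := by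
  have : (m + 1 : ℝ) ≠ 0 := by positivity
  simp [this]

theorem sum_noise : ∑ ω, noise c m ω = 1 := by
  rw [Fintype.sum_prod_type, ← sum_uniform m]
  refine Finset.sum_congr rfl fun s _ => ?_
  simpa using sum_noise_fst (c := c) s 1

/-- Only the states `s` and `s + 1` move to `s`, so the density after the move is a difference of
values of `moveProb`. -/
theorem sum_noise_signalIndex (j a : Fin k) (s : Fin (m + 1)) :
    ∑ ω with signalIndex j a ω = s, noise c m ω
      = tilt (fun _ => 1 / (m + 1)) (tiltDensity c m) j a s := by
  rw [Finset.sum_filter, Fintype.sum_prod_type]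
  simp only [Fintype.sum_bool, signalIndex, tilt]
  by_cases h : a = j
  · simp only [h, if_true, target, Bool.false_eq_true, if_false, Finset.sum_add_distrib, noise,
      Finset.sum_ite_eq', Finset.mem_univ]
    have h1 : ∑ i : Fin (m + 1), (if (⟨i - 1, by omega⟩ : Fin (m + 1)) = s
        then 1 / (m + 1 : ℝ) * moveProb c m i else 0) = 1 / (m + 1) * moveProb c m (s + 1) := by
      simp only [Fin.ext_iff]
      rw [Fin.sum_univ_eq_sum_range (fun i => if i - 1 = (s : ℕ)
        then 1 / (m + 1 : ℝ) * moveProb c m i else 0) (m + 1)]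
      have h2 : (if m + 1 - 1 = (s : ℕ) then 1 / (m + 1 : ℝ) * moveProb c m (m + 1) else 0) = 0 := by
        simp [moveProb]
      have h3 := Finset.sum_range_succ (fun i => if i - 1 = (s : ℕ)
        then 1 / (m + 1 : ℝ) * moveProb c m i else 0) (m + 1)
      rw [h2, add_zero] at h3
      rw [← h3, Finset.sum_range_succ']
      simp only [Nat.add_sub_cancel, Finset.sum_ite_eq', Finset.mem_range, s.isLt, if_true]
      simp [moveProb]
    rw [h1]
    simp only [moveProb, tiltDensity]
    push_cast
    ring
  · simp only [h, if_false, Finset.sum_add_distrib, Finset.sum_ite_eq', Finset.mem_univ, if_true,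
      mul_one]
    simpa using sum_noise_fst (c := c) s 1

theorem sum_tiltDensity : ∑ i, 1 / (m + 1 : ℝ) * tiltDensity c m i = 1 := by
  have h : ∀ n : ℕ, ∑ i ∈ Finset.range n, (1 + c * (m - 2 * i)) = n + c * n * (m + 1 - n) := by
    intro n
    induction n with
    | zero => simp
    | succ n ih => rw [Finset.sum_range_succ, ih]; push_cast; ring
  have hm : (m + 1 : ℝ) ≠ 0 := by positivity
  rw [← Finset.mul_sum]
  simp only [tiltDensity]
  rw [Fin.sum_univ_eq_sum_range (fun i => 1 + c * (m - 2 * (i : ℝ))) (m + 1), h]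
  push_cast
  field_simp
  ring

/-- The mean advantage of the distinguished action. -/
theorem sum_noise_mul_drop (hε : 0 < ε) :
    ∑ ω, noise c m ω * drop ε m ω = c * m * (m + 2) / 12 := by
  have h1 : ∀ i : Fin (m + 1), ∑ b, noise c m (i, b) * drop ε m (i, b)
      = 1 / (m + 1) * (1 / 2) * moveProb c m i := by
    intro i
    simp only [drop_eq hε, Fintype.sum_bool, noise]
    by_cases h : (i : ℕ) = 0
    · simp [h, moveProb]
    · simp [h]
      ring
  have h : ∀ n : ℕ, ∑ i ∈ Finset.range n, moveProb c m i
      = c * ((m + 1) * (n * (n - 1) / 2) - (n - 1) * n * (2 * n - 1) / 6) := by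
    intro n
    induction n with
    | zero => simp
    | succ n ih => rw [Finset.sum_range_succ, ih, moveProb]; push_cast; ring
  have hm : (m + 1 : ℝ) ≠ 0 := by positivity
  rw [Fintype.sum_prod_type]
  simp only [h1]
  rw [← Finset.mul_sum, Fin.sum_univ_eq_sum_range (moveProb c m) (m + 1), h]
  push_cast
  field_simp
  ring

/-- The relative entropy of the uniform distribution with respect to the one after the move is at most
twice the variance of the density. -/
theorem sum_neg_log_tiltDensity_le (hw : ∀ i, 1 / 2 ≤ tiltDensity c m i) :
    ∑ i, 1 / (m + 1 : ℝ) * -Real.log (tiltDensity c m i) ≤ 2 / 3 * c ^ 2 * (m * (m + 2)) := by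
  have h1 : ∀ i : Fin (m + 1), -Real.log (tiltDensity c m i)
      ≤ (1 - tiltDensity c m i) + 2 * c ^ 2 * ((m : ℝ) - 2 * (i : ℝ)) ^ 2 := by
    intro i
    have hpos : 0 < tiltDensity c m i := by linarith [hw i]
    have h2 := Real.log_le_sub_one_of_pos (inv_pos.2 hpos)
    rw [Real.log_inv] at h2
    have h3 : (tiltDensity c m i)⁻¹ ≤ 2 := by
      rw [inv_le_comm₀ hpos (by norm_num)]
      linarith [hw i]
    have h4 : (tiltDensity c m i)⁻¹ - 1
        = (1 - tiltDensity c m i) + (c * (m - 2 * i)) ^ 2 * (tiltDensity c m i)⁻¹ := by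
      have : c * (m - 2 * i) = tiltDensity c m i - 1 := by simp [tiltDensity]
      rw [this]
      field_simp
      ring
    have h5 := mul_le_mul_of_nonneg_left h3 (sq_nonneg (c * ((m : ℝ) - 2 * i)))
    linarith
  have hm : (0 : ℝ) < 1 / (m + 1) := by positivity
  have h : ∀ n : ℕ, ∑ i ∈ Finset.range n, ((m : ℝ) - 2 * (i : ℝ)) ^ 2
      = (n : ℝ) * m ^ 2 - 2 * m * n * (n - 1) + 2 * (n - 1) * n * (2 * n - 1) / 3 := by
    intro n
    induction n with
    | zero => simp
    | succ n ih => rw [Finset.sum_range_succ, ih]; push_cast; ring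
  refine (Finset.sum_le_sum fun i _ => mul_le_mul_of_nonneg_left (h1 i) hm.le).trans_eq ?_
  have hm' : (m + 1 : ℝ) ≠ 0 := by positivity
  have h2 : ∀ i : Fin (m + 1), 1 / (m + 1 : ℝ)
        * ((1 - tiltDensity c m i) + 2 * c ^ 2 * (m - 2 * i) ^ 2)
      = (1 / (m + 1 : ℝ) - 1 / (m + 1 : ℝ) * tiltDensity c m i)
        + 1 / (m + 1 : ℝ) * (2 * c ^ 2) * ((m : ℝ) - 2 * (i : ℝ)) ^ 2 := fun i => by ring
  simp only [h2]
  rw [Finset.sum_add_distrib, Finset.sum_sub_distrib, sum_uniform, sum_tiltDensity,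
    ← Finset.mul_sum, Fin.sum_univ_eq_sum_range (fun i => ((m : ℝ) - 2 * (i : ℝ)) ^ 2) (m + 1), h]
  push_cast
  field_simp
  ring

end Environment

/-! ### The actions of a policy as an adaptive process -/

section Regret

variable {k d T : ℕ}

theorem Policy.sum_real_kernel (p : Policy k T) (t : Fin T) (h : Fin (t : ℕ) → Fin k × ℝ) :
    ∑ a, (p.kernel t h).real {a} = 1 := by
  have := p.markov t
  rw [sum_measureReal_singleton]
  simp

/-- The probability that the policy plays `a` after the actions `h`, against the fixed loss vectors
`l`, which determine the signals. -/
noncomputable def Game.actionKernel (G : Game k d) (p : Policy k T) (l : Fin T → (Fin d → ℝ))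
    (t : Fin T) (h : Fin (t : ℕ) → Fin k) (a : Fin k) : ℝ :=
  (p.kernel t fun s => (h s, G.signal (h s) (l (s.castLE t.isLt.le)))).real {a}

theorem Game.actionProb_eq_law (G : Game k d) (p : Policy k T) (l : Fin T → (Fin d → ℝ))
    (A : Fin T → Fin k) : G.actionProb p l A = law (G.actionKernel p l) A := rfl

theorem Game.sum_actionKernel (G : Game k d) (p : Policy k T) (l : Fin T → (Fin d → ℝ))
    (t : Fin T) (h : Fin (t : ℕ) → Fin k) : ∑ a, G.actionKernel p l t h a = 1 :=
  p.sum_real_kernel t _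

theorem Game.sum_actionProb (G : Game k d) (p : Policy k T) (l : Fin T → (Fin d → ℝ)) :
    ∑ A, G.actionProb p l A = 1 :=
  sum_law (G.sum_actionKernel p l)

theorem Game.sum_actionProb_mul_sub (G : Game k d) (p : Policy k T) (l : Fin T → (Fin d → ℝ))
    (b : Fin k) :
    ∑ A, G.actionProb p l A * ∑ t, (G.actionLoss (A t) (l t) - G.actionLoss b (l t))
      = ∑ A, G.actionProb p l A * ∑ t, G.actionLoss (A t) (l t) - ∑ t, G.actionLoss b (l t) := by
  simp only [Finset.sum_sub_distrib, mul_sub, ← Finset.sum_mul, G.sum_actionProb, one_mul]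

theorem Game.le_regret (G : Game k d) (p : Policy k T) (l : Fin T → (Fin d → ℝ)) (b : Fin k) :
    ∑ A, G.actionProb p l A * ∑ t, (G.actionLoss (A t) (l t) - G.actionLoss b (l t))
      ≤ G.regret p l := by
  rw [G.sum_actionProb_mul_sub]
  exact sub_le_sub_left (ciInf_le (f := fun a => ∑ t, G.actionLoss a (l t))
    (Set.finite_range _).bddBelow b) _

theorem Game.exists_regret_eq [Nonempty (Fin k)] (G : Game k d) (p : Policy k T)
    (l : Fin T → (Fin d → ℝ)) :
    ∃ b, G.regret p l
      = ∑ A, G.actionProb p l A * ∑ t, (G.actionLoss (A t) (l t) - G.actionLoss b (l t)) := by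
  obtain ⟨b, hb⟩ := exists_eq_ciInf_of_finite (f := fun a : Fin k => ∑ t, G.actionLoss a (l t))
  exact ⟨b, by rw [G.sum_actionProb_mul_sub, Game.regret, ← hb]⟩

end Regret

/-! ### The lower bound -/

section LowerBound

variable {k m T : ℕ} {ε c : ℝ}

/-- The probability that the policy plays `a` after actions and signals `h`, the signals being given
by their indices on the grid. -/
noncomputable def gridPolicy (p : Policy k T) (ε : ℝ) (m : ℕ) (t : Fin T)
    (h : Fin (t : ℕ) → Fin k × Fin (m + 1)) (a : Fin k) : ℝ :=
  (p.kernel t fun s => ((h s).1, grid ε m (h s).2)).real {a}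

/-- The mean regret against the randomized environment is at least the mean advantage of the
distinguished action times the expected number of rounds in which it is not played. -/
theorem le_sum_noise_mul_regret (hk : 2 ≤ k) (hε : 0 < ε) (hν : ∀ ω, 0 ≤ noise c m ω)
    (p : Policy k T) (j : Fin k) :
    c * m * (m + 2) / 12 * (T - ∑ A,
        law (banditKernel (gridPolicy p ε m)
          (tilt (fun _ => 1 / (m + 1)) (tiltDensity c m) j)) A * plays j A)
      ≤ ∑ ω : Fin T → Fin (m + 1) × Bool, (∏ t, noise c m (ω t))
        * (illConditionedBandit k ε).regret p fun t => envLoss ε m j (ω t) := by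
  classical
  set Φ : Fin k × (Fin (m + 1) × Bool) → Fin k × Fin (m + 1) :=
    fun x => (x.1, signalIndex j x.1 x.2) with hΦ
  set π' : (t : Fin T) → (Fin (t : ℕ) → Fin k × (Fin (m + 1) × Bool)) → Fin k → ℝ :=
    fun t h => gridPolicy p ε m t (Φ ∘ h) with hπ'
  have hπ1 : ∀ t h, ∑ a, gridPolicy p ε m t h a = 1 := fun t h => p.sum_real_kernel t _
  have hπ1' : ∀ t h, ∑ a, π' t h a = 1 := fun t h => hπ1 t _
  have hν1 : ∀ _a : Fin k, ∑ ω, noise c m ω = 1 := fun _ => sum_noise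
  -- The joint law of actions and noise.
  have hjoint : ∀ (ω : Fin T → Fin (m + 1) × Bool) (A : Fin T → Fin k), (∏ t, noise c m (ω t))
        * (illConditionedBandit k ε).actionProb p (fun t => envLoss ε m j (ω t)) A
      = law (banditKernel π' fun _ => noise c m) (fun t => (A t, ω t)) := by
    intro ω A
    rw [mul_comm, Game.actionProb, ← Finset.prod_mul_distrib]
    refine Finset.prod_congr rfl fun t _ => ?_
    have h : (illConditionedBandit k ε).history (fun t => envLoss ε m j (ω t)) A t
        = fun s => ((Φ (past (fun t => (A t, ω t)) t s)).1,
          grid ε m (Φ (past (fun t => (A t, ω t)) t s)).2) :=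
      funext fun s => Prod.ext rfl (signal_envLoss hk hε j _ _)
    rw [h]
    rfl
  have hpush : ∑ x, law (banditKernel π' fun _ => noise c m) x * plays j x
      = ∑ A, law (banditKernel (gridPolicy p ε m)
          (tilt (fun _ => 1 / (m + 1)) (tiltDensity c m) j)) A * plays j A := by
    rw [← sum_law_comp Φ (κ := banditKernel π' fun _ => noise c m)]
    · rfl
    · rintro t h ⟨a, s⟩
      rw [banditKernel, ← sum_noise_signalIndex, Finset.sum_filter, Fintype.sum_prod_type,
        Finset.mul_sum, Finset.sum_filter]
      rw [Finset.sum_eq_single a]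
      · refine Finset.sum_congr rfl fun ω _ => ?_
        simp [hΦ, banditKernel, hπ']
      · intro b _ hb
        simp [hΦ, hb]
      · simp
  have hreg : ∀ ω : Fin T → Fin (m + 1) × Bool,
      ∑ A, (illConditionedBandit k ε).actionProb p (fun t => envLoss ε m j (ω t)) A
          * ∑ t, (if A t = j then 0 else drop ε m (ω t))
        ≤ (illConditionedBandit k ε).regret p fun t => envLoss ε m j (ω t) := by
    intro ω
    refine le_trans (le_of_eq ?_) (Game.le_regret _ p _ j)
    refine Finset.sum_congr rfl fun A _ => ?_
    congr 1
    refine Finset.sum_congr rfl fun t _ => ?_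
    simp only [actionLoss_illConditionedBandit, envLoss, if_true]
    split_ifs <;> ring
  calc _ = ∑ x, law (banditKernel π' fun _ => noise c m) x
          * ∑ t, (if (x t).1 = j then 0 else drop ε m (x t).2) := by
        have hE : ∀ t : Fin T, ∑ x, law (banditKernel π' fun _ => noise c m) x
              * (if (x t).1 = j then 0 else drop ε m (x t).2)
            = c * m * (m + 2) / 12 * ∑ x, law (banditKernel π' fun _ => noise c m) x
              * (1 - if (x t).1 = j then 1 else 0) := by
          intro t
          rw [sum_law_banditKernel_mul hπ1' hν1 t fun a ω => if a = j then 0 else drop ε m ω,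
            Finset.mul_sum]
          refine Finset.sum_congr rfl fun x _ => ?_
          by_cases h : (x t).1 = j
          · simp [h]
          · simp only [h, if_false, sum_noise_mul_drop hε]
            ring
        simp only [Finset.mul_sum]
        rw [Finset.sum_comm, Finset.sum_congr rfl fun t _ => hE t, ← Finset.mul_sum,
          Finset.sum_comm, ← hpush]
        have h1 : ∑ x, law (banditKernel π' fun _ => noise c m) x = 1 :=
          sum_law (sum_banditKernel hπ1' hν1)
        simp only [← Finset.mul_sum, Finset.sum_sub_distrib]
        simp [mul_sub, ← Finset.sum_mul, h1, plays]
    _ = ∑ ω : Fin T → Fin (m + 1) × Bool, (∏ t, noise c m (ω t))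
          * ∑ A, (illConditionedBandit k ε).actionProb p (fun t => envLoss ε m j (ω t)) A
            * ∑ t, (if A t = j then 0 else drop ε m (ω t)) := by
        simp only [Finset.mul_sum (s := Finset.univ (α := Fin T → Fin k)), ← mul_assoc, hjoint]
        rw [Finset.sum_comm, ← Fintype.sum_prod_type']
        exact Fintype.sum_equiv (Equiv.arrowProdEquivProdArrow (Fin T) (fun _ => Fin k)
          fun _ => Fin (m + 1) × Bool) _ _ fun x => rfl
    _ ≤ _ := Finset.sum_le_sum fun ω _ =>
        mul_le_mul_of_nonneg_left (hreg ω) (Finset.prod_nonneg fun t _ => hν (ω t))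

/-- For every policy there are loss vectors against which its regret is large, for every mean
advantage `Δ` that is so small that the signals do not reveal the distinguished action. -/
theorem exists_le_regret (hk : 2 ≤ k) (hε : 0 < ε) (hε1 : ε ≤ 1) {Δ : ℝ} (hΔ0 : 0 ≤ Δ)
    (hΔ1 : Δ ≤ 1 / 8) (hΔ : 32 * (Δ * ε) ^ 2 * (T / k) ≤ 1 / 16) (p : Policy k T) :
    ∃ l : Fin T → (illConditionedBandit k ε).Loss,
      Δ * T / 4 ≤ (illConditionedBandit k ε).regret p fun t => (l t : Fin k → ℝ) := by
  -- The grid fills an interval of length close to `1`.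
  set m : ℕ := ⌊2 / ε⌋₊ with hm
  have hm0 : (2 : ℝ) ≤ m := by
    exact_mod_cast Nat.le_floor (by rw [Nat.cast_ofNat, le_div_iff₀ hε]; linarith)
  have hm1 : ε * m ≤ 2 := by
    have := Nat.floor_le (a := 2 / ε) (by positivity)
    rwa [le_div_iff₀' hε] at this
  have hm2 : 2 < ε * (m + 1) := by
    have := Nat.lt_floor_add_one (2 / ε)
    rwa [div_lt_iff₀' hε] at this
  have hmm : (0 : ℝ) < m * (m + 2) := by positivity
  -- The scale of the tilt for which the mean advantage is `Δ`.
  set c : ℝ := 12 * Δ / (m * (m + 2)) with hc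
  have hc0 : 0 ≤ c := by positivity
  have hcm : c * (m * (m + 2)) = 12 * Δ := div_mul_cancel₀ _ hmm.ne'
  have hcm' : c * m ≤ 3 / 8 := by nlinarith [mul_nonneg hc0 (by linarith : (0 : ℝ) ≤ m)]
  have hdens : ∀ i, 1 / 2 ≤ tiltDensity c m i := by
    intro i
    have h1 : (i : ℝ) ≤ m := by exact_mod_cast Nat.le_of_lt_succ i.isLt
    rw [tiltDensity]
    nlinarith [mul_le_mul_of_nonneg_left h1 hc0]
  have hν : ∀ ω, 0 ≤ noise c m ω := by
    rintro ⟨i, b⟩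
    have h1 : (i : ℝ) ≤ m := by exact_mod_cast Nat.le_of_lt_succ i.isLt
    have h2 : (0 : ℝ) ≤ i := Nat.cast_nonneg _
    have h3 : 0 ≤ moveProb c m i := mul_nonneg (mul_nonneg hc0 h2) (by linarith)
    have h4 : moveProb c m i ≤ 1 := by
      have h5 : (i : ℝ) * (m + 1 - i) ≤ m * (m + 2) / 2 := by
        nlinarith [sq_nonneg ((i : ℝ) - (m + 1) / 2)]
      rw [moveProb, mul_assoc]
      nlinarith [mul_le_mul_of_nonneg_left h5 hc0]
    refine mul_nonneg (by positivity) ?_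
    dsimp only
    split_ifs <;> linarith
  have hkl : (∑ i, 1 / (m + 1 : ℝ) * -Real.log (tiltDensity c m i)) * (T / k) ≤ 1 / 16 := by
    refine le_trans (mul_le_mul_of_nonneg_right ?_ (by positivity)) hΔ
    refine (sum_neg_log_tiltDensity_le hdens).trans ?_
    have h1 : 3 ≤ ε ^ 2 * (m * (m + 2)) := by nlinarith
    have h2 : 2 / 3 * c ^ 2 * (m * (m + 2)) * 3 ≤ 2 / 3 * (c * (m * (m + 2))) ^ 2 * ε ^ 2 := by
      have := mul_le_mul_of_nonneg_left h1
        (by positivity : 0 ≤ 2 / 3 * c ^ 2 * ((m : ℝ) * (m + 2)))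
      linarith
    rw [hcm] at h2
    linarith
  obtain ⟨j, hj⟩ := exists_plays_tilt_le hk (π := gridPolicy p ε m)
    (fun t h a => measureReal_nonneg) (fun t h => p.sum_real_kernel t _)
    (u := fun _ => 1 / (m + 1 : ℝ)) (w := tiltDensity c m) (fun _ => by positivity)
    (sum_uniform m) (fun i => lt_of_lt_of_le (by norm_num) (hdens i)) sum_tiltDensity hkl
  have hmean := le_sum_noise_mul_regret (m := m) hk hε hν p j
  obtain ⟨ω, hω⟩ := Finite.exists_max fun ω : Fin T → Fin (m + 1) × Bool =>
    (illConditionedBandit k ε).regret p fun t => envLoss ε m j (ω t)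
  refine ⟨fun t => ⟨envLoss ε m j (ω t), (mem_loss_illConditionedBandit ε _).2
    (abs_envLoss_le hk hε hε1 hm1 j (ω t))⟩, ?_⟩
  have hsum : ∑ ω : Fin T → Fin (m + 1) × Bool, ∏ t, noise c m (ω t) = 1 :=
    sum_law (κ := fun _ _ => noise c m) fun _ _ => sum_noise
  have hmax := hmean.trans (Finset.sum_le_sum fun ω' _ => mul_le_mul_of_nonneg_left (hω ω')
    (Finset.prod_nonneg fun t _ => hν (ω' t)))
  rw [← Finset.sum_mul, hsum, one_mul] at hmax
  refine le_trans ?_ hmax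
  have h1 : c * m * (m + 2) / 12 = Δ := by linear_combination hcm / 12
  rw [h1]
  nlinarith [mul_le_mul_of_nonneg_left hj hΔ0]

theorem le_minimaxRegret (hk : 2 ≤ k) (hε : 0 < ε) (hε1 : ε ≤ 1)
    (hT : (k : ℝ) ≤ 8 * ε ^ 2 * T * Real.log (16 * T)) :
    ((1 / (64 * √(2 * Real.log (16 * T))) * (1 / ε * √(k * T)) : ℝ) : EReal)
      ≤ (illConditionedBandit k ε).minimaxRegret T := by
  have hk0 : (0 : ℝ) < k := by positivity
  have hT1 : (1 : ℝ) ≤ T := by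
    rcases Nat.eq_zero_or_pos T with rfl | h
    · simp at hT
      omega
    · exact_mod_cast h
  have hT0 : (0 : ℝ) < T := by linarith
  set lg := Real.log (16 * T) with hlg
  have hlg1 : 1 ≤ lg := by
    rw [hlg, Real.le_log_iff_exp_le (by positivity)]
    linarith [Real.exp_one_lt_d9]
  have hs : 0 < √(2 * lg) := Real.sqrt_pos.2 (by linarith)
  set R : ℝ := 1 / (64 * √(2 * lg)) * (1 / ε * √(k * T)) with hR
  have hR0 : 0 ≤ R := by positivity
  have hRsq : R ^ 2 * (64 ^ 2 * (2 * lg) * ε ^ 2) = k * T := by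
    have h1 : R * (64 * √(2 * lg) * ε) = √(k * T) := by
      rw [hR]
      field_simp
    rw [← Real.sq_sqrt (by positivity : (0 : ℝ) ≤ k * T), ← h1,
      ← Real.sq_sqrt (by positivity : 0 ≤ 2 * lg), Real.sqrt_sq hs.le]
    ring
  have hΔ1 : 4 * R / T ≤ 1 / 8 := by
    have h1 : 0 < 8 * ε ^ 2 * lg := by positivity
    have h2 : 8 * ε ^ 2 * lg * (32 * R) ^ 2 ≤ 8 * ε ^ 2 * lg * T ^ 2 := by
      nlinarith [mul_le_mul_of_nonneg_right hT hT0.le]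
    have h3 := (pow_le_pow_iff_left₀ (by positivity) hT0.le two_ne_zero).1
      (le_of_mul_le_mul_left h2 h1)
    rw [div_le_iff₀ hT0]
    linarith
  have hΔ2 : 32 * (4 * R / T * ε) ^ 2 * (T / k) ≤ 1 / 16 := by
    have h1 : 32 * (4 * R / T * ε) ^ 2 * (T / k) = 512 * R ^ 2 * ε ^ 2 / (k * T) := by
      field_simp
      ring
    rw [h1, div_le_iff₀ (by positivity), ← hRsq]
    nlinarith [mul_nonneg (sub_nonneg.2 hlg1) (by positivity : 0 ≤ R ^ 2 * ε ^ 2)]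
  refine le_iInf fun p => ?_
  obtain ⟨l, hl⟩ := exists_le_regret hk hε hε1 (by positivity) hΔ1 hΔ2 p
  refine le_iSup_of_le l (EReal.coe_le_coe_iff.2 (le_trans (le_of_eq ?_) hl))
  field_simp

end LowerBound

/-! ### Exponential weights for exploration and exploitation -/

section ExpWeights

variable {k T : ℕ}

/-- The probability of the action `a` under exponential weights with learning rate `η` and cumulative
losses `L`. -/
noncomputable def expWeights (η : ℝ) (L : Fin k → ℝ) (a : Fin k) : ℝ :=
  Real.exp (-η * L a) / ∑ b, Real.exp (-η * L b)

/-- The importance-weighted loss estimate after playing `x.1` with distribution `q` and seeing the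
signal `x.2`, which is rescaled from `[-1, 1]` to `[0, 1]`. -/
noncomputable def lossEst (q : Fin k → ℝ) (x : Fin k × ℝ) (a : Fin k) : ℝ :=
  if x.1 = a then (1 + x.2) / 2 / q a else 0

/-- The cumulative loss estimates of Exp3 with learning rate `η` after the history `h`. -/
noncomputable def cumLossEst (η : ℝ) : (t : ℕ) → (Fin t → Fin k × ℝ) → Fin k → ℝ
  | 0, _ => 0
  | t + 1, h => fun a => cumLossEst η t (fun s => h s.castSucc) a
      + lossEst (expWeights η (cumLossEst η t fun s => h s.castSucc)) (h (Fin.last t)) a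

/-- The distribution from which Exp3 draws its action after the history `h`. -/
noncomputable def exp3 (η : ℝ) (t : ℕ) (h : Fin t → Fin k × ℝ) : Fin k → ℝ :=
  expWeights η (cumLossEst η t h)

theorem expWeights_pos (η : ℝ) (L : Fin k → ℝ) (a : Fin k) : 0 < expWeights η L a :=
  div_pos (Real.exp_pos _) (Finset.sum_pos (fun _ _ => Real.exp_pos _) ⟨a, Finset.mem_univ a⟩)

theorem sum_expWeights [Nonempty (Fin k)] (η : ℝ) (L : Fin k → ℝ) : ∑ a, expWeights η L a = 1 := by
  have h : 0 < ∑ b, Real.exp (-η * L b) :=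
    Finset.sum_pos (fun _ _ => Real.exp_pos _) Finset.univ_nonempty
  simp only [expWeights]
  rw [← Finset.sum_div, div_self h.ne']

theorem measurable_expWeights {α : Type*} [MeasurableSpace α] (η : ℝ) {L : α → Fin k → ℝ}
    (hL : ∀ a, Measurable fun x => L x a) (a : Fin k) :
    Measurable fun x => expWeights η (L x) a :=
  ((hL a).const_mul _).exp.div
    (Finset.measurable_sum _ fun b _ => ((hL b).const_mul _).exp)

theorem measurable_cumLossEst (η : ℝ) (t : ℕ) (a : Fin k) :
    Measurable fun h : Fin t → Fin k × ℝ => cumLossEst η t h a := by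
  induction t generalizing a with
  | zero => exact measurable_const
  | succ t ih =>
    have hpast : Measurable fun (h : Fin (t + 1) → Fin k × ℝ) (s : Fin t) => h s.castSucc :=
      measurable_pi_lambda _ fun s => measurable_pi_apply _
    have hlast : Measurable fun h : Fin (t + 1) → Fin k × ℝ => h (Fin.last t) :=
      measurable_pi_apply _
    refine ((ih a).comp hpast).add (Measurable.ite (hlast.fst (measurableSet_singleton a)) ?_
      measurable_const)
    exact ((measurable_const.add hlast.snd).div_const 2).div
      (measurable_expWeights η (fun b => (ih b).comp hpast) a)

theorem measurable_exp3 (η : ℝ) (t : ℕ) (a : Fin k) :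
    Measurable fun h : Fin t → Fin k × ℝ => exp3 η t h a :=
  measurable_expWeights η (measurable_cumLossEst η t) a

/-- Exp3 as a policy. -/
noncomputable def exp3Policy (k T : ℕ) [Nonempty (Fin k)] (η : ℝ) : Policy k T where
  kernel t :=
    { toFun := fun h => ∑ a, ENNReal.ofReal (exp3 η t h a) • Measure.dirac a
      measurable' := by
        refine Measure.measurable_of_measurable_coe _ fun s _ => ?_
        simp only [Measure.coe_finsetSum, Finset.sum_apply, Measure.smul_apply, smul_eq_mul]
        exact Finset.measurable_sum _ fun a _ =>
          (measurable_exp3 η t a).ennreal_ofReal.mul_const _ }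
  markov t := ⟨fun h => ⟨by
    change (∑ a, ENNReal.ofReal (exp3 η t h a) • Measure.dirac a : Measure (Fin k)) Set.univ = 1
    simp only [Measure.coe_finsetSum, Finset.sum_apply, Measure.smul_apply, smul_eq_mul,
      measure_univ, mul_one]
    simp only [exp3]
    rw [← ENNReal.ofReal_sum_of_nonneg fun a _ => (expWeights_pos η _ a).le, sum_expWeights,
      ENNReal.ofReal_one]⟩⟩

theorem exp3Policy_real_singleton [Nonempty (Fin k)] (η : ℝ) (t : Fin T)
    (h : Fin (t : ℕ) → Fin k × ℝ) (a : Fin k) :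
    ((exp3Policy k T η).kernel t h).real {a} = exp3 η t h a := by
  change (∑ a, ENNReal.ofReal (exp3 η t h a) • Measure.dirac a : Measure (Fin k)).real {a} = _
  simp only [measureReal_def, Measure.coe_finsetSum, Finset.sum_apply, Measure.smul_apply,
    smul_eq_mul]
  rw [Finset.sum_eq_single a]
  · simp [(expWeights_pos η _ a).le, exp3]
  · intro b _ hb
    simp [hb]
  · simp

theorem cumLossEst_eq_sum (η : ℝ) (H : Fin T → Fin k × ℝ) (a : Fin k) :
    cumLossEst η T H a = ∑ t : Fin T, lossEst (exp3 η t (past H t)) (H t) a := by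
  induction T with
  | zero => rfl
  | succ T ih =>
    rw [Fin.sum_univ_castSucc]
    exact congrArg (· + _) (ih fun t => H t.castSucc)

theorem exp_neg_le_quadratic {x : ℝ} (hx : 0 ≤ x) : Real.exp (-x) ≤ 1 - x + x ^ 2 / 2 := by
  have h1 := Real.quadratic_le_exp_of_nonneg hx
  have h2 : 0 < 1 - x + x ^ 2 / 2 := by nlinarith [sq_nonneg (x - 1)]
  rw [Real.exp_neg, inv_le_comm₀ (Real.exp_pos x) h2]
  refine le_trans ?_ h1
  rw [inv_le_iff_one_le_mul₀ h2]
  nlinarith [sq_nonneg (x ^ 2)]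

/-- One round changes the logarithm of the total weight by at most the first two terms of its
expansion, as the loss estimates are nonnegative. -/
theorem log_sum_exp_add_lossEst_le [Nonempty (Fin k)] {η : ℝ} (hη : 0 ≤ η) (L : Fin k → ℝ)
    {x : Fin k × ℝ} (hx : 0 ≤ 1 + x.2) :
    Real.log (∑ b, Real.exp (-η * (L b + lossEst (expWeights η L) x b)))
      ≤ Real.log (∑ b, Real.exp (-η * L b)) + (-η * ((1 + x.2) / 2)
        + η ^ 2 / 2 * (((1 + x.2) / 2) ^ 2 / expWeights η L x.1)) := by
  set q := expWeights η L with hq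
  set W := ∑ b, Real.exp (-η * L b) with hW
  set y := (1 + x.2) / 2 with hy
  have hy0 : 0 ≤ y := by linarith
  have hWpos : 0 < W := Finset.sum_pos (fun _ _ => Real.exp_pos _) Finset.univ_nonempty
  have hqpos : 0 < q x.1 := expWeights_pos η L _
  have hfac : ∑ b, Real.exp (-η * (L b + lossEst q x b))
      = W * ∑ b, q b * Real.exp (-(η * lossEst q x b)) := by
    rw [Finset.mul_sum]
    refine Finset.sum_congr rfl fun b _ => ?_
    have h1 : W * q b = Real.exp (-η * L b) := mul_div_cancel₀ _ hWpos.ne'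
    rw [← mul_assoc, h1, ← Real.exp_add]
    ring_nf
  have hsplit : ∑ b, q b * Real.exp (-(η * lossEst q x b))
      = 1 + q x.1 * (Real.exp (-(η * (y / q x.1))) - 1) := by
    have h1 : ∀ b, q b * Real.exp (-(η * lossEst q x b))
        = q b + if x.1 = b then q x.1 * (Real.exp (-(η * (y / q x.1))) - 1) else 0 := by
      intro b
      by_cases h : x.1 = b
      · simp only [lossEst, h, if_true]
        ring
      · simp [lossEst, h]
    simp only [h1, Finset.sum_add_distrib, Finset.sum_ite_eq, Finset.mem_univ, if_true]
    rw [hq, sum_expWeights]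
  have hpos : 0 < ∑ b, q b * Real.exp (-(η * lossEst q x b)) :=
    Finset.sum_pos (fun b _ => mul_pos (expWeights_pos η L b) (Real.exp_pos _))
      Finset.univ_nonempty
  rw [hfac, Real.log_mul hWpos.ne' hpos.ne']
  refine add_le_add le_rfl ((Real.log_le_sub_one_of_pos hpos).trans ?_)
  rw [hsplit]
  have h1 := exp_neg_le_quadratic (x := η * (y / q x.1)) (by positivity)
  have h2 : q x.1 * (Real.exp (-(η * (y / q x.1))) - 1)
      ≤ q x.1 * (-(η * (y / q x.1)) + (η * (y / q x.1)) ^ 2 / 2) :=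
    mul_le_mul_of_nonneg_left (by linarith) hqpos.le
  have h3 : q x.1 * (-(η * (y / q x.1)) + (η * (y / q x.1)) ^ 2 / 2)
      = -η * y + η ^ 2 / 2 * (y ^ 2 / q x.1) := by
    field_simp
  linarith

theorem log_sum_exp_cumLossEst_le [Nonempty (Fin k)] {η : ℝ} (hη : 0 ≤ η) (H : Fin T → Fin k × ℝ)
    (hH : ∀ t, 0 ≤ 1 + (H t).2) :
    Real.log (∑ b, Real.exp (-η * cumLossEst η T H b))
      ≤ Real.log k + ∑ t, (-η * ((1 + (H t).2) / 2)
        + η ^ 2 / 2 * (((1 + (H t).2) / 2) ^ 2 / exp3 η t (past H t) (H t).1)) := by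
  induction T with
  | zero => simp [cumLossEst]
  | succ T ih =>
    rw [Fin.sum_univ_castSucc, ← add_assoc]
    refine (log_sum_exp_add_lossEst_le hη _ (hH (Fin.last T))).trans ?_
    exact add_le_add (ih (fun t => H t.castSucc) fun t => hH _) le_rfl

/-- The regret bound of exponential weights along one history, in terms of the loss estimates. -/
theorem sum_loss_le [Nonempty (Fin k)] {η : ℝ} (hη : 0 < η) (H : Fin T → Fin k × ℝ)
    (hH : ∀ t, 0 ≤ 1 + (H t).2) (b : Fin k) :
    ∑ t, (1 + (H t).2) / 2 ≤ ∑ t : Fin T, lossEst (exp3 η t (past H t)) (H t) b + Real.log k / η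
      + η / 2 * ∑ t, ((1 + (H t).2) / 2) ^ 2 / exp3 η t (past H t) (H t).1 := by
  have h1 := log_sum_exp_cumLossEst_le hη.le H hH
  have h2 : -η * cumLossEst η T H b ≤ Real.log (∑ b, Real.exp (-η * cumLossEst η T H b)) := by
    rw [Real.le_log_iff_exp_le
      (Finset.sum_pos (fun _ _ => Real.exp_pos _) ⟨b, Finset.mem_univ b⟩)]
    exact Finset.single_le_sum (f := fun b => Real.exp (-η * cumLossEst η T H b))
      (fun _ _ => (Real.exp_pos _).le) (Finset.mem_univ b)
  rw [Finset.sum_add_distrib, ← Finset.mul_sum, ← Finset.mul_sum] at h1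
  rw [cumLossEst_eq_sum] at h2
  refine le_of_mul_le_mul_left ?_ hη
  rw [mul_add, mul_add, mul_div_cancel₀ _ hη.ne']
  linarith

end ExpWeights

/-! ### The upper bound -/

section UpperBound

variable {k T : ℕ} {ε : ℝ}

theorem abs_signal_le [Nonempty (Fin k)] (hε : 0 < ε) (hε1 : ε ≤ 1) (a : Fin k) {l : Fin k → ℝ}
    (hl : ∀ b, |l b| ≤ 1) : |(illConditionedBandit k ε).signal a l| ≤ 1 := by
  have hk : (0 : ℝ) < k := by
    exact_mod_cast Fin.pos_iff_nonempty.2 ‹_›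
  rw [signal_illConditionedBandit]
  have h1 : |1 / (k : ℝ) * ∑ b, l b| ≤ 1 := by
    rw [abs_mul, abs_of_nonneg (by positivity), div_mul_eq_mul_div, one_mul, div_le_one hk]
    refine (Finset.abs_sum_le_sum_abs _ _).trans ((Finset.sum_le_sum fun b _ => hl b).trans ?_)
    simp
  have h2 := abs_le.1 h1
  have h3 := abs_le.1 (hl a)
  rw [mul_assoc, abs_le]
  constructor <;> nlinarith [h2.1, h2.2, h3.1, h3.2]

/-- The regret of Exp3 as a function of the learning rate. Signals of two actions differ by `ε`
times the difference of the losses, so the regret is `2 / ε` times that of the rescaled signals. -/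
theorem regret_exp3Policy_le [Nonempty (Fin k)] (hε : 0 < ε) (hε1 : ε ≤ 1) {η : ℝ} (hη : 0 < η)
    {l : Fin T → Fin k → ℝ} (hl : ∀ t a, |l t a| ≤ 1) :
    (illConditionedBandit k ε).regret (exp3Policy k T η) l
      ≤ 2 / ε * (Real.log k / η + η / 2 * (k * T)) := by
  set G := illConditionedBandit k ε
  set p := exp3Policy k T η
  obtain ⟨b, hb⟩ := G.exists_regret_eq p l
  rw [hb]
  set y : Fin T → Fin k → ℝ := fun t a => (1 + G.signal a (l t)) / 2 with hy
  have hsig : ∀ t a, |G.signal a (l t)| ≤ 1 := fun t a =>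
    abs_signal_le hε hε1 a (hl t)
  have hy0 : ∀ t a, 0 ≤ y t a := fun t a => by
    simp only [hy]; linarith [(abs_le.1 (hsig t a)).1]
  have hy1 : ∀ t a, y t a ≤ 1 := fun t a => by
    simp only [hy]; linarith [(abs_le.1 (hsig t a)).2]
  set κ := G.actionKernel p l with hκ
  have hκ1 : ∀ t h, ∑ a, κ t h a = 1 := G.sum_actionKernel p l
  -- The history of actions and signals that belongs to a sequence of actions.
  set H : (Fin T → Fin k) → Fin T → Fin k × ℝ := fun A t => (A t, G.signal (A t) (l t)) with hH
  have hκH : ∀ A t a, κ t (past A t) a = exp3 η t (past (H A) t) a := fun A t a =>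
    exp3Policy_real_singleton η t _ a
  have hκpos : ∀ t h a, 0 < κ t h a := fun t h a =>
    (expWeights_pos _ _ _).trans_eq (exp3Policy_real_singleton η t _ a).symm
  have hdiff : ∀ t a, G.actionLoss a (l t) - G.actionLoss b (l t)
      = 2 / ε * (y t a - y t b) := by
    intro t a
    simp only [hy, G, actionLoss_illConditionedBandit, signal_illConditionedBandit]
    field_simp
    ring
  -- The loss estimates are unbiased.
  have hunb : ∀ t, ∑ A, G.actionProb p l A * lossEst (κ t (past A t)) (H A t) b = y t b := by
    intro t
    simp only [G.actionProb_eq_law]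
    rw [sum_law_mul hκ1 t fun h a => lossEst (κ t h) (a, G.signal a (l t)) b]
    have h1 : ∀ h, ∑ a, κ t h a * lossEst (κ t h) (a, G.signal a (l t)) b = y t b := by
      intro h
      rw [Finset.sum_eq_single b]
      · simp only [lossEst, if_true]
        exact mul_div_cancel₀ _ (hκpos t h b).ne'
      · intro a _ ha
        simp [lossEst, ha]
      · simp
    simp only [h1, ← Finset.sum_mul]
    rw [sum_law hκ1, one_mul]
  have hvar : ∀ t, ∑ A, G.actionProb p l A * (y t (A t) ^ 2 / κ t (past A t) (A t)) ≤ k := by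
    intro t
    simp only [G.actionProb_eq_law]
    rw [sum_law_mul hκ1 t fun h a => y t a ^ 2 / κ t h a]
    have h1 : ∀ h, ∑ a, κ t h a * (y t a ^ 2 / κ t h a) = ∑ a, y t a ^ 2 := fun h =>
      Finset.sum_congr rfl fun a _ => mul_div_cancel₀ _ (hκpos t h a).ne'
    simp only [h1, ← Finset.sum_mul]
    rw [sum_law hκ1, one_mul]
    refine (Finset.sum_le_sum fun a _ => pow_le_one₀ (hy0 t a) (hy1 t a)).trans_eq ?_
    simp
  have hprob0 : ∀ A, 0 ≤ G.actionProb p l A := fun A =>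
    law_nonneg (fun t h a => (hκpos t h a).le) A
  have hpath : ∀ A : Fin T → Fin k, ∑ t, y t (A t)
      ≤ ∑ t, lossEst (κ t (past A t)) (H A t) b + Real.log k / η
        + η / 2 * ∑ t, y t (A t) ^ 2 / κ t (past A t) (A t) := by
    intro A
    have h1 := sum_loss_le hη (H A) (fun t => by linarith [(abs_le.1 (hsig t (A t))).1]) b
    have h2 : ∀ t, κ t (past A t) = exp3 η t (past (H A) t) := fun t => funext (hκH A t)
    simp only [h2]
    exact h1
  simp only [hdiff, ← Finset.mul_sum, mul_left_comm _ (2 / ε)]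
  refine mul_le_mul_of_nonneg_left ?_ (by positivity)
  have hmean := Finset.sum_le_sum fun A (_ : A ∈ Finset.univ) =>
    mul_le_mul_of_nonneg_left (hpath A) (hprob0 A)
  have hE1 : ∑ A, G.actionProb p l A * ∑ t, lossEst (κ t (past A t)) (H A t) b = ∑ t, y t b := by
    simp only [Finset.mul_sum]
    rw [Finset.sum_comm]
    exact Finset.sum_congr rfl fun t _ => hunb t
  have hE2 : ∑ A, G.actionProb p l A * ∑ t, y t (A t) ^ 2 / κ t (past A t) (A t) ≤ k * T := by
    simp only [Finset.mul_sum]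
    rw [Finset.sum_comm]
    refine (Finset.sum_le_sum fun t _ => hvar t).trans_eq ?_
    simp [mul_comm]
  simp only [mul_add, Finset.sum_add_distrib, hE1, ← Finset.sum_mul, G.sum_actionProb, one_mul,
    mul_left_comm _ (η / 2)] at hmean
  rw [← Finset.mul_sum] at hmean
  simp only [Finset.sum_sub_distrib, mul_sub, ← Finset.sum_mul, G.sum_actionProb, one_mul]
  linarith [mul_le_mul_of_nonneg_left hE2 (by positivity : 0 ≤ η / 2)]

theorem minimaxRegret_le (hk : 2 ≤ k) (hε : 0 < ε) (hε1 : ε ≤ 1) :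
    (illConditionedBandit k ε).minimaxRegret T
      ≤ ((3 * (1 / ε * √(k * T * Real.log k)) : ℝ) : EReal) := by
  have : Nonempty (Fin k) := ⟨⟨0, by omega⟩⟩
  have hlog : 0 < Real.log k := Real.log_pos (by exact_mod_cast hk)
  rcases Nat.eq_zero_or_pos T with rfl | hT
  · refine iInf_le_of_le (exp3Policy k 0 1) (iSup_le fun l => EReal.coe_le_coe_iff.2 ?_)
    simp [Game.regret]
  have hkT : (0 : ℝ) < k * T := by positivity
  -- The learning rate that balances the two terms.
  set η := √(Real.log k / (k * T)) with hη
  have hη0 : 0 < η := Real.sqrt_pos.2 (by positivity)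
  refine iInf_le_of_le (exp3Policy k T η) (iSup_le fun l => EReal.coe_le_coe_iff.2 ?_)
  refine (regret_exp3Policy_le hε hε1 hη0 fun t =>
    (mem_loss_illConditionedBandit ε _).1 (l t).2).trans_eq ?_
  have h1 : η ^ 2 * (k * T) = Real.log k := by
    rw [hη, Real.sq_sqrt (by positivity), div_mul_cancel₀ _ hkT.ne']
  have h2 : √(k * T * Real.log k) = η * (k * T) := by
    rw [← h1, show (k * T : ℝ) * (η ^ 2 * (k * T)) = (η * (k * T)) ^ 2 by ring,
      Real.sqrt_sq (by positivity)]
  rw [h2, ← h1]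
  field_simp
  ring

end UpperBound

end LinearPM

theorem mainTheorem5 :
    (∀ (k T : ℕ) (ε : ℝ), 2 ≤ k → 0 < ε → ε ≤ 1 →
      (k : ℝ) ≤ 8 * ε ^ 2 * (T : ℝ) * Real.log (16 * (T : ℝ)) →
      ((1 / (64 * Real.sqrt (2 * Real.log (16 * (T : ℝ)))) *
          (1 / ε * Real.sqrt ((k : ℝ) * (T : ℝ))) : ℝ) : EReal)
        ≤ (LinearPM.illConditionedBandit k ε).minimaxRegret T) ∧
    (∃ C : ℝ, 0 < C ∧ ∀ (k T : ℕ) (ε : ℝ), 2 ≤ k → 0 < ε → ε ≤ 1 →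
      (LinearPM.illConditionedBandit k ε).minimaxRegret T
        ≤ ((C * (1 / ε * Real.sqrt ((k : ℝ) * (T : ℝ) * Real.log (k : ℝ))) : ℝ) : EReal)) := by
  exact ⟨fun _ _ _ hk hε hε1 hT => LinearPM.le_minimaxRegret hk hε hε1 hT,
    3, by norm_num, fun _ _ _ hk hε hε1 => LinearPM.minimaxRegret_le hk hε hε1⟩
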